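/- Let $\mathbb F_q$ be a finite field with $q$ elements and characteristic $p$, let $n$ be a positive integer dividing $q-1$, and let $0<n_1,n_2,n_3<n$ be integers. Put $a_i=n_i\frac{q-1}{n}$ for $i=1,2,3$. Let $\epsilon_{q-1}$ be a primitive $(q-1)$-th root of unity, fix a prime of $\mathbb Z[\epsilon_{q-1}]$ above $p$ together with an identification of its residue field with $\mathbb F_q$, and let $\chi_q:\mathbb F_q\to\mathbb Z[\epsilon_{q-1}]$ be the Teichmüller character, i.e. the multiplicative character (with $\chi_q(0)=0$) such that $\chi_q(z)\equiv z$ modulo this prime. For $\alpha\in\mathbb F_q$ let $f=x^{n_1}(x-1)^{n_2}(x-\alpha)^{n_3}$ and consider the covering $y^n=f$ of $\mathbb P^1$ over $\mathbb F_q$, with function field $\mathbb F_q(x)(\sqrt[n]{f})$. Let $\chi_f$ be the character of its Galois group given by $\chi_f(\sigma)=\chi_q\big(\sigma(\sqrt[n]{f})/\sqrt[n]{f}\big)$. For a closed point $x$ of $\mathbb P^1$ outside $T=\{0,1,\alpha,\infty\}$ let $F_x$ be the Frobenius element at $x$, and put $\chi_f(F_x)=0$ for $x\in T$. Let $$L(\mathbb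 P^1_q,\chi_f,t)=\prod_{x\in|\mathbb P^1|}\bigl(1-\chi_f(F_x)\,t^{\deg x}\bigr)^{-1},$$ the product being over all closed points of $\mathbb P^1$ over $\mathbb F_q$, and let $c_1(q,\alpha)$ be the coefficient of $t$ in this power series. Suppose that $a_3=a_2$, $2(a_1+a_2)\equiv 0 \bmod (q-1)$, and $a_1+a_2\neq q-1$. If $\alpha^{\frac{q-1}{2}}=-1$ in $\mathbb F_q$, then $c_1(q,\alpha)=0$. (These hypotheses force $q$ to be odd, $\alpha\neq 0,1$, and the covering to be ramified at all four points of $T$.) -/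

import Mathlib

open Polynomial
open scoped NumberField

noncomputable section

namespace JacobiLSeries

/-! ### The Teichmüller character -/

/-- The cyclotomic field `ℚ(ε_{q-1})`, where `q = #F`. -/
abbrev CycField (F : Type*) [Fintype F] : Type :=
  CyclotomicField (Fintype.card F - 1) ℚ

/-- Let `π : ℤ[ε_{q-1}] → F` be the reduction modulo a prime above `p` with residue field `F`.
There is a multiplicative character `χ` of `F` with `χ(z) ≡ z` modulo that prime. -/
theorem exists_teichmuller {F : Type*} [Field F] [Fintype F] (π : 𝓞 (CycField F) →+* F) :
    ∃ χ : MulChar F (𝓞 (CycField F)), ∀ z : F, π (χ z) = z := by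
  classical
  have hcard : 1 < Fintype.card F := Fintype.one_lt_card
  have : NeZero (Fintype.card F - 1) := ⟨by omega⟩
  have : NeZero ((Fintype.card F - 1 : ℕ) : ℚ) := ⟨Nat.cast_ne_zero.2 (by omega)⟩
  have hcast : ((Fintype.card F - 1 : ℕ) : F) ≠ 0 := by
    rw [Nat.cast_sub hcard.le, FiniteField.cast_card_eq_zero]
    simp
  have : NeZero ((Fintype.card F - 1 : ℕ) : F) := ⟨hcast⟩
  obtain ⟨ζ₀, h0⟩ := (CyclotomicField.isCyclotomicExtension (Fintype.card F - 1)
    ℚ).exists_isPrimitiveRoot rfl (NeZero.ne _)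
  have h1 := h0.toInteger_isPrimitiveRoot
  have h2 : IsPrimitiveRoot (π h0.toInteger) (Fintype.card F - 1) := by
    rw [← isRoot_cyclotomic_iff]
    have := h1.isRoot_cyclotomic (NeZero.pos _)
    have h3 := this.map (f := π)
    rwa [map_cyclotomic] at h3
  obtain ⟨g, hg⟩ := IsCyclic.exists_generator (α := Fˣ)
  have hgpow : (g : F) ^ (Fintype.card F - 1) = 1 := FiniteField.pow_card_sub_one_eq_one _ g.ne_zero
  obtain ⟨i, -, hi⟩ := h2.eq_pow_of_pow_eq_one hgpow
  have hζ : (h0.toInteger ^ i) ^ (Fintype.card F - 1) = 1 := by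
    rw [← pow_mul, mul_comm, pow_mul, h1.pow_eq_one, one_pow]
  let ζ := Units.ofPowEqOne _ _ hζ (NeZero.ne _)
  have hζmem : ζ ∈ rootsOfUnity (Fintype.card Fˣ) (𝓞 (CycField F)) := by
    rw [mem_rootsOfUnity, Fintype.card_units]
    exact Units.pow_ofPowEqOne _ _
  refine ⟨MulChar.ofRootOfUnity hζmem hg, fun z => ?_⟩
  rcases eq_or_ne z 0 with rfl | hz
  · rw [MulChar.map_zero, map_zero]
  · obtain ⟨k, hk⟩ := (Submonoid.mem_powers_iff _ _).1
      ((mem_powers_iff_mem_zpowers).2 (hg (Units.mk0 z hz)))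
    have hzk : z = (g : F) ^ k := by
      rw [← Units.val_pow_eq_pow_val, hk, Units.val_mk0]
    rw [hzk, map_pow, map_pow, MulChar.ofRootOfUnity_spec]
    congr 1
    simpa [ζ] using hi

/-- The Teichmüller character `χ_q : F → ℤ[ε_{q-1}]`: the multiplicative character (zero at `0`)
with `χ_q(z) ≡ z` modulo the chosen prime of `ℤ[ε_{q-1}]`, the kernel of the reduction `π`. -/
def teichmuller {F : Type*} [Field F] [Fintype F] (π : 𝓞 (CycField F) →+* F) :
    MulChar F (𝓞 (CycField F)) :=
  (exists_teichmuller π).choose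

theorem teichmuller_spec {F : Type*} [Field F] [Fintype F] (π : 𝓞 (CycField F) →+* F) (z : F) :
    π (teichmuller π z) = z :=
  (exists_teichmuller π).choose_spec z

/-! ### Closed points of the projective line -/

/-- The closed points of `ℙ¹` over `F`: those of the affine line, given by the monic irreducible
polynomials, and the point at infinity. -/
inductive ClosedPoint (F : Type*) [Field F] : Type _
  | finite (P : F[X]) (monic : P.Monic) (irred : Irreducible P) : ClosedPoint F
  | infty : ClosedPoint F

namespace ClosedPoint

/-- The degree over `F` of the residue field of a closed point. -/
def degree {F : Type*} [Field F] : ClosedPoint F → ℕ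
  | finite P _ _ => P.natDegree
  | infty => 1

/-- There are finitely many closed points of bounded degree. -/
theorem finite_degree_le (F : Type*) [Field F] [Finite F] (k : ℕ) :
    {x : ClosedPoint F | x.degree ≤ k}.Finite := by
  classical
  let e : ClosedPoint F → Option (Fin (k + 1) → F) := fun x =>
    match x with
    | finite P _ _ => some fun i => P.coeff i
    | infty => none
  refine Set.Finite.of_injOn (f := e) (t := Set.univ) (fun _ _ => Set.mem_univ _) ?_
    Set.finite_univ
  rintro (⟨P, hP, iP⟩ | _) hx (⟨Q, hQ, iQ⟩ | _) hy h
  · have hPQ : P = Q := by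
      ext m
      by_cases hm : m < k + 1
      · exact congrFun (Option.some.inj h) ⟨m, hm⟩
      · have h1 : P.natDegree ≤ k := hx
        have h2 : Q.natDegree ≤ k := hy
        rw [coeff_eq_zero_of_natDegree_lt (by omega), coeff_eq_zero_of_natDegree_lt (by omega)]
    subst hPQ
    rfl
  · exact absurd h (by simp [e])
  · exact absurd h (by simp [e])
  · rfl

end ClosedPoint

/-! ### The cyclic covering `yⁿ = f` of the projective line -/

/-- The function field `F(x)(ⁿ√f)` of the covering `yⁿ = f`. (It is the splitting field of
`Yⁿ - f` over `F(x)`; in use `n` divides `q - 1`, so `F` contains the `n`-th roots of unity.) -/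
abbrev CoverField {F : Type*} [Field F] (n : ℕ) (f : F[X]) : Type _ :=
  (X ^ n - C (algebraMap F[X] (RatFunc F) f) : (RatFunc F)[X]).SplittingField

/-- The Galois group of the covering `yⁿ = f`. -/
abbrev CoverGroup {F : Type*} [Field F] (n : ℕ) (f : F[X]) : Type _ :=
  CoverField n f ≃ₐ[RatFunc F] CoverField n f

/-- The coordinate ring of the affine part of the covering curve: the integral closure of `F[x]`
in its function field. -/
abbrev CoverRing {F : Type*} [Field F] (n : ℕ) (f : F[X]) : Type _ :=
  integralClosure F[X] (CoverField n f)

/-- `σ` is a Frobenius element at the affine closed point `P`: for some prime `Q` of the covering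
curve above `P`, we have `σ b ≡ b ^ N mod Q` for all `b`, with `N` the cardinality of the residue
field of `P`. -/
def IsFrobeniusOver {F : Type*} [Field F] (n : ℕ) (f P : F[X]) (σ : CoverGroup n f) : Prop :=
  ∃ Q : Ideal (CoverRing n f), Q.IsPrime ∧ Q.under F[X] = Ideal.span {P} ∧ IsArithFrobAt F[X] σ Q

/-- The Frobenius element `F_x` at an affine closed point `P`. It exists always, and it is unique
if `P` is unramified, the Galois group being abelian. -/
def frobenius {F : Type*} [Field F] (n : ℕ) (f P : F[X]) : CoverGroup n f :=
  Classical.epsilon (IsFrobeniusOver n f P)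

/-- The `n`-th root of unity `μ ∈ F` with `σ(y) = μ y` for `y = ⁿ√f`. (It does not depend on
the choice of `y`.) -/
def kummer {F : Type*} [Field F] (n : ℕ) (f : F[X]) (σ : CoverGroup n f) : F :=
  Classical.epsilon fun μ : F => ∀ y : CoverField n f,
    y ^ n = algebraMap F[X] (CoverField n f) f →
      σ y = algebraMap (RatFunc F) (CoverField n f) (algebraMap F (RatFunc F) μ) * y

/-- The character `χ_f` of the Galois group: `χ_f(σ) = χ_q(σ(y)/y)` for `y = ⁿ√f`. -/
def galoisChar {F : Type*} [Field F] [Fintype F] (π : 𝓞 (CycField F) →+* F) (n : ℕ) (f : F[X])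
    (σ : CoverGroup n f) : 𝓞 (CycField F) :=
  teichmuller π (kummer n f σ)

/-- The value `χ_f(F_x)` at a closed point `x` of `ℙ¹`, zero at the ramification points. Here all
the zeros of `f` and the point at infinity are ramification points, that is, neither the order
of a geometric zero of `f` nor the degree of `f` is divisible by `n`. -/
def charAt {F : Type*} [Field F] [Fintype F] (π : 𝓞 (CycField F) →+* F) (n : ℕ) (f : F[X]) :
    ClosedPoint F → 𝓞 (CycField F)
  | .finite P _ _ => open Classical in
      if P ∣ f then 0 else galoisChar π n f (frobenius n f P)
  | .infty => 0

/-! ### The L-series -/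

/-- The Euler factor `(1 - χ_f(F_x) t^{deg x})⁻¹`. -/
def eulerFactor {F : Type*} [Field F] [Fintype F] (π : 𝓞 (CycField F) →+* F) (n : ℕ) (f : F[X])
    (x : ClosedPoint F) : PowerSeries (CycField F) :=
  (1 - PowerSeries.C (charAt π n f x : CycField F) * PowerSeries.X ^ x.degree)⁻¹

/-- The `L`-series `L(ℙ¹, χ_f, t) = ∏_x (1 - χ_f(F_x) t^{deg x})⁻¹`, a formal power series in `t`.
The factors at points of degree greater than `k` are `1` modulo `t^{k+1}`, so the coefficient of
`t^k` in the infinite product is the one in the finite product over the points of degree at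
most `k`. -/
def lSeries {F : Type*} [Field F] [Fintype F] (π : 𝓞 (CycField F) →+* F) (n : ℕ) (f : F[X]) :
    PowerSeries (CycField F) :=
  PowerSeries.mk fun k => PowerSeries.coeff k
    (∏ x ∈ (ClosedPoint.finite_degree_le F k).toFinset, eulerFactor π n f x)

/-- The polynomial `x^{n₁} (x-1)^{n₂} (x-α)^{n₃}`. -/
def curvePoly {F : Type*} [Field F] (n₁ n₂ n₃ : ℕ) (α : F) : F[X] :=
  X ^ n₁ * (X - 1) ^ n₂ * (X - C α) ^ n₃

end JacobiLSeries

end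

open JacobiLSeries

/-
The coefficient `c₁` is the sum of the values `χ_f(F_x)` over the points of degree one. At a
rational point `c` the Frobenius element raises `ⁿ√f` to its `q`-th power modulo a prime above `c`,
so it multiplies `ⁿ√f` by `f(c) ^ ((q - 1) / n)`. Hence `c₁ = ∑ A(c) B(c - 1) B(c - α)` with
`A = χ_q ^ a₁` and `B = χ_q ^ a₂`. As `(AB)² = 1`, the involution `c ↦ α / c` of `ℙ¹`, which
permutes `T`, multiplies this sum by `(AB)(α)`; and `(AB)(α) = -1`, because `a₁ + a₂` is an odd
multiple of `(q - 1) / 2`.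
-/

namespace JacobiLSeries

section FiniteField

variable {F : Type*} [Field F] [Fintype F]

theorem pos_of_dvd_card_sub_one {n : ℕ} (hn : n ∣ Fintype.card F - 1) : 0 < n :=
  Nat.pos_of_dvd_of_pos hn (Nat.sub_pos_of_lt Fintype.one_lt_card)

theorem div_pos_of_dvd_card_sub_one {n : ℕ} (hn : n ∣ Fintype.card F - 1) :
    0 < (Fintype.card F - 1) / n :=
  pos_of_dvd_card_sub_one (Nat.div_dvd_of_dvd hn)

theorem mul_div_lt_card_sub_one {k n : ℕ} (hn : n ∣ Fintype.card F - 1) (hk : k < n) :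
    k * ((Fintype.card F - 1) / n) < Fintype.card F - 1 :=
  (Nat.mul_lt_mul_of_pos_right hk (div_pos_of_dvd_card_sub_one hn)).trans_eq
    (Nat.mul_div_cancel' hn)

theorem natCast_ne_zero_of_dvd_card_sub_one {n : ℕ} (hn : n ∣ Fintype.card F - 1) :
    (n : F) ≠ 0 := by
  intro h
  have hcard : ((Fintype.card F - 1 : ℕ) : F) = 0 := zero_dvd_iff.1 (h ▸ Nat.cast_dvd_cast hn)
  rw [Nat.cast_sub Fintype.card_pos, FiniteField.cast_card_eq_zero] at hcard
  simp at hcard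

theorem card_sub_one_dvd_natCard_sub_one (V : Type*) [AddCommGroup V] [Module F V]
    [Module.Finite F V] : Fintype.card F - 1 ∣ Nat.card V - 1 := by
  rw [Module.natCard_eq_pow_finrank (K := F), Nat.card_eq_fintype_card]
  simpa only [one_pow] using Nat.sub_dvd_pow_sub_pow (Fintype.card F) 1 (Module.finrank F V)

theorem exists_algebraMap_eq_of_pow_card_eq_self {L : Type*} [CommRing L] [IsDomain L] [Algebra F L]
    {x : L} (hx : x ^ Fintype.card F = x) : ∃ a : F, algebraMap F L a = x := by
  have hsplits : (X ^ Fintype.card F - X : F[X]).Splits := by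
    rw [splits_iff_card_roots, FiniteField.roots_X_pow_card_sub_X,
      FiniteField.X_pow_card_sub_X_natDegree_eq F Fintype.one_lt_card]
    rfl
  have hroots := hsplits.roots_map (algebraMap F L)
  have hmem : x ∈ ((X ^ Fintype.card F - X : F[X]).map (algebraMap F L)).roots := by
    rw [mem_roots_map_of_injective (algebraMap F L).injective
      (FiniteField.X_pow_card_sub_X_ne_zero F Fintype.one_lt_card)]
    simp [hx]
  rw [hroots] at hmem
  obtain ⟨a, -, ha⟩ := Multiset.mem_map.1 hmem
  exact ⟨a, ha⟩

theorem exists_algebraMap_eq_of_pow_eq_one {L : Type*} [CommRing L] [IsDomain L] [Algebra F L]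
    {n : ℕ} (hn : n ∣ Fintype.card F - 1) {ζ : L} (hζ : ζ ^ n = 1) :
    ∃ a : F, algebraMap F L a = ζ := by
  obtain ⟨m, hm⟩ := hn
  refine exists_algebraMap_eq_of_pow_card_eq_self ?_
  rw [← Nat.sub_add_cancel (Fintype.card_pos (α := F)), pow_succ, hm, pow_mul, hζ, one_pow, one_mul]

end FiniteField

section Cover

variable {F : Type*} [Field F] {n : ℕ} {f P : F[X]}

theorem algebraMap_coverField_injective :
    Function.Injective (algebraMap F[X] (CoverField n f)) := by
  rw [IsScalarTower.algebraMap_eq F[X] (RatFunc F) (CoverField n f)]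
  exact (algebraMap (RatFunc F) (CoverField n f)).injective.comp (IsFractionRing.injective _ _)

instance : FaithfulSMul F[X] (CoverRing n f) :=
  (faithfulSMul_iff_algebraMap_injective _ _).2 fun _ _ h =>
    algebraMap_coverField_injective (congrArg Subtype.val h)

theorem exists_pow_eq (hn : n ≠ 0) :
    ∃ z : CoverRing n f, z ^ n = algebraMap F[X] (CoverRing n f) f := by
  obtain ⟨y, hy⟩ := (SplittingField.splits
    (X ^ n - C (algebraMap F[X] (RatFunc F) f) : (RatFunc F)[X])).exists_eval_eq_zero (by
      rw [degree_map, degree_X_pow_sub_C (Nat.pos_of_ne_zero hn)]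
      exact_mod_cast hn)
  have hyf : y ^ n = algebraMap F[X] (CoverField n f) f := by
    rw [IsScalarTower.algebraMap_apply F[X] (RatFunc F) (CoverField n f)]
    simpa [sub_eq_zero] using hy
  have hint : IsIntegral F[X] y :=
    .of_pow (Nat.pos_of_ne_zero hn) (hyf ▸ isIntegral_algebraMap)
  exact ⟨⟨y, hint⟩, Subtype.ext hyf⟩

theorem isGalois_coverField (hn : (n : F) ≠ 0) (hf : f ≠ 0) :
    IsGalois (RatFunc F) (CoverField n f) := by
  have hnK : (n : RatFunc F) ≠ 0 := by
    simpa only [map_natCast] using (map_ne_zero (algebraMap F (RatFunc F))).2 hn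
  exact .of_separable_splitting_field
    (p := (X ^ n - C (algebraMap F[X] (RatFunc F) f) : (RatFunc F)[X]))
    (separable_X_pow_sub_C _ hnK (by simpa using hf))

theorem isGaloisGroup_coverRing (hn : (n : F) ≠ 0) (hf : f ≠ 0) :
    IsGaloisGroup (CoverGroup n f) F[X] (CoverRing n f) := by
  have := isGalois_coverField hn hf
  have : IsFractionRing (CoverRing n f) (CoverField n f) :=
    IsIntegralClosure.isFractionRing_of_finite_extension F[X] (RatFunc F) (CoverField n f) _
  exact .of_isFractionRing (CoverGroup n f) F[X] (CoverRing n f) (RatFunc F) (CoverField n f)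

theorem exists_isFrobeniusOver [Finite F] (hn : (n : F) ≠ 0) (hf : f ≠ 0) (hP : Irreducible P) :
    ∃ σ, IsFrobeniusOver n f P σ := by
  have := isGalois_coverField hn hf
  have := isGaloisGroup_coverRing hn hf
  have : Module.Finite F[X] (CoverRing n f) :=
    IsIntegralClosure.finite F[X] (RatFunc F) (CoverField n f) (CoverRing n f)
  have : (Ideal.span {P}).IsPrime := (Ideal.span_singleton_prime hP.ne_zero).2 hP.prime
  obtain ⟨⟨Q, hQ, hQP⟩⟩ := Ideal.nonempty_primesOver (S := CoverRing n f) (Ideal.span {P})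
  have : Module.Finite F (F[X] ⧸ Ideal.span {P}) := (AdjoinRoot.powerBasis hP.ne_zero).finite
  have : Finite (F[X] ⧸ Ideal.span {P}) := Module.finite_of_finite F
  have : Finite (CoverRing n f ⧸ Q) := Module.finite_of_finite (F[X] ⧸ Ideal.span {P})
  obtain ⟨σ, hσ⟩ := IsArithFrobAt.exists_of_isInvariant F[X] (CoverGroup n f) Q
  exact ⟨σ, Q, hQ, hQP.over.symm, hσ⟩

theorem isFrobeniusOver_frobenius [Finite F] (hn : (n : F) ≠ 0) (hf : f ≠ 0)
    (hP : Irreducible P) : IsFrobeniusOver n f P (frobenius n f P) :=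
  Classical.epsilon_spec (exists_isFrobeniusOver hn hf hP)

theorem apply_eq_kummer_mul [Fintype F] (hn : n ∣ Fintype.card F - 1) (hf : f ≠ 0)
    (σ : CoverGroup n f) {y : CoverField n f} (hy : y ^ n = algebraMap F[X] (CoverField n f) f) :
    σ y =
      algebraMap (RatFunc F) (CoverField n f) (algebraMap F (RatFunc F) (kummer n f σ)) * y := by
  have hf' : algebraMap F[X] (CoverField n f) f ≠ 0 :=
    (map_ne_zero_iff _ algebraMap_coverField_injective).2 hf
  have hy0 : y ≠ 0 := by
    rintro rfl
    exact hf' (by rw [← hy, zero_pow (pos_of_dvd_card_sub_one hn).ne'])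
  have hσf : σ (algebraMap F[X] (CoverField n f) f) = algebraMap F[X] (CoverField n f) f :=
    (σ.restrictScalars F[X]).commutes f
  -- `σ y / y` and the quotient of two `n`-th roots of `f` are `n`-th roots of unity, so lie in `F`.
  obtain ⟨μ, hμ⟩ := exists_algebraMap_eq_of_pow_eq_one hn (ζ := σ y / y) (by
    rw [div_pow, ← map_pow, hy, hσf, div_self hf'])
  have hroot : ∃ μ : F, ∀ z : CoverField n f, z ^ n = algebraMap F[X] (CoverField n f) f →
      σ z = algebraMap (RatFunc F) (CoverField n f) (algebraMap F (RatFunc F) μ) * z := by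
    refine ⟨μ, fun z hz => ?_⟩
    obtain ⟨ν, hν⟩ := exists_algebraMap_eq_of_pow_eq_one hn (ζ := z / y) (by
      rw [div_pow, hz, hy, div_self hf'])
    rw [IsScalarTower.algebraMap_apply F (RatFunc F) (CoverField n f), eq_div_iff hy0] at hμ hν
    rw [← hν, map_mul, σ.commutes, ← hμ, mul_left_comm]
  exact Classical.epsilon_spec hroot y hy

/-- The Frobenius element acts on `ⁿ√f` by the `n`-th power residue symbol of `f` at `P`. -/
theorem IsFrobeniusOver.dvd_pow_sub_C_kummer [Fintype F] (hn : n ∣ Fintype.card F - 1)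
    (hPf : ¬P ∣ f) {σ : CoverGroup n f} (hσ : IsFrobeniusOver n f P σ) :
    P ∣ f ^ ((Nat.card (F[X] ⧸ Ideal.span {P}) - 1) / n) - C (kummer n f σ) := by
  obtain ⟨Q, hQ, hQP, hfrob⟩ := hσ
  have hmem {g : F[X]} : algebraMap F[X] (CoverRing n f) g ∈ Q ↔ P ∣ g := by
    rw [← Ideal.mem_comap, ← Ideal.under_def, hQP, Ideal.mem_span_singleton]
  have hf : f ≠ 0 := fun h => hPf (h ▸ dvd_zero P)
  have hn0 : 0 < n := pos_of_dvd_card_sub_one hn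
  have hcard := hfrob.card_pos
  have : Finite (F[X] ⧸ Q.under F[X]) := hfrob.finite_quotient
  have hdvd : n ∣ Nat.card (F[X] ⧸ Q.under F[X]) - 1 :=
    hn.trans (card_sub_one_dvd_natCard_sub_one _)
  obtain ⟨z, hz⟩ := exists_pow_eq (f := f) hn0.ne'
  have hzQ : z ∉ Q := fun h => hPf (hmem.1 (hz ▸ Ideal.pow_mem_of_mem Q h n hn0))
  have hσz : σ • z = algebraMap F[X] (CoverRing n f) (C (kummer n f σ)) * z :=
    Subtype.ext (apply_eq_kummer_mul hn hf σ (congrArg Subtype.val hz))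
  have hzN : z ^ Nat.card (F[X] ⧸ Q.under F[X]) = algebraMap F[X] (CoverRing n f)
      (f ^ ((Nat.card (F[X] ⧸ Q.under F[X]) - 1) / n)) * z := by
    rw [map_pow, ← hz, ← pow_mul, Nat.mul_div_cancel' hdvd, ← pow_succ, Nat.sub_add_cancel hcard]
  have hmul := hfrob z
  rw [MulSemiringAction.toAlgHom_apply, hσz, hzN, ← sub_mul, ← map_sub, hQP] at hmul
  exact dvd_sub_comm.1 (hmem.1 ((hQ.mem_or_mem hmul).resolve_right hzQ))

theorem kummer_frobenius_X_sub_C [Fintype F] (hn : n ∣ Fintype.card F - 1) {c : F}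
    (hc : f.eval c ≠ 0) :
    kummer n f (frobenius n f (X - C c)) = f.eval c ^ ((Fintype.card F - 1) / n) := by
  have hf : f ≠ 0 := fun h => hc (by rw [h, eval_zero])
  have hdvd := (isFrobeniusOver_frobenius (natCast_ne_zero_of_dvd_card_sub_one hn) hf
    (irreducible_X_sub_C c)).dvd_pow_sub_C_kummer hn (mt dvd_iff_isRoot.1 hc)
  have hcard : Nat.card (F[X] ⧸ Ideal.span {X - C c}) = Fintype.card F := by
    rw [Nat.card_congr (quotientSpanXSubCAlgEquiv c).toEquiv, Nat.card_eq_fintype_card]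
  rw [hcard, dvd_iff_isRoot, IsRoot.def, eval_sub, eval_pow, eval_C, sub_eq_zero] at hdvd
  exact hdvd.symm

end Cover

namespace ClosedPoint

variable {F : Type*} [Field F]

/-- The rational point of the affine line with coordinate `c`. -/
noncomputable def affine (c : F) : ClosedPoint F :=
  .finite (X - C c) (monic_X_sub_C c) (irreducible_X_sub_C c)

theorem affine_injective : Function.Injective (affine : F → ClosedPoint F) := fun c d h => by
  simpa [affine] using h

theorem degree_pos (x : ClosedPoint F) : 0 < x.degree := by
  cases x with
  | finite P _ irred => exact irred.natDegree_pos
  | infty => exact Nat.one_pos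

theorem degree_le_one_iff {x : ClosedPoint F} : x.degree ≤ 1 ↔ x = infty ∨ ∃ c, affine c = x := by
  constructor
  · intro hx
    cases x with
    | infty => exact .inl rfl
    | finite P monic irred =>
      have hP : P = X + C (P.coeff 0) := monic.eq_X_add_C (hx.antisymm irred.natDegree_pos)
      refine .inr ⟨-P.coeff 0, ?_⟩
      simp only [affine, finite.injEq, C_neg, sub_neg_eq_add]
      exact hP.symm
  · rintro (rfl | ⟨c, rfl⟩)
    · exact le_rfl
    · exact (natDegree_X_sub_C c).le

theorem sum_degree_le_one [Fintype F] {M : Type*} [AddCommMonoid M] (g : ClosedPoint F → M) :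
    ∑ x ∈ (finite_degree_le F 1).toFinset, g x = g infty + ∑ c, g (affine c) := by
  classical
  have hpoints : (finite_degree_le F 1).toFinset =
      insert infty (Finset.univ.map ⟨affine, affine_injective⟩) := by
    ext x
    simp [degree_le_one_iff]
  rw [hpoints, Finset.sum_insert (by simp [affine]), Finset.sum_map]
  rfl

end ClosedPoint

theorem coeff_one_prod_of_constantCoeff_eq_one {ι R : Type*} [CommSemiring R] (s : Finset ι)
    (f : ι → PowerSeries R) (hf : ∀ i ∈ s, PowerSeries.constantCoeff (f i) = 1) :
    PowerSeries.coeff 1 (∏ i ∈ s, f i) = ∑ i ∈ s, PowerSeries.coeff 1 (f i) := by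
  induction s using Finset.cons_induction with
  | empty => simp [PowerSeries.coeff_one]
  | cons i s hi ih =>
    rw [Finset.forall_mem_cons] at hf
    have hs : PowerSeries.constantCoeff (∏ j ∈ s, f j) = 1 := by
      rw [map_prod, Finset.prod_eq_one hf.2]
    rw [Finset.prod_cons, Finset.sum_cons, PowerSeries.coeff_one_mul, hs, hf.1, ih hf.2, mul_one,
      mul_one]

section LSeries

variable {F : Type*} [Field F] [Fintype F] (π : 𝓞 (CycField F) →+* F)

theorem constantCoeff_eulerFactor (n : ℕ) (f : F[X]) (x : ClosedPoint F) :
    PowerSeries.constantCoeff (eulerFactor π n f x) = 1 := by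
  simp [eulerFactor, x.degree_pos.ne']

theorem coeff_one_eulerFactor (n : ℕ) (f : F[X]) {x : ClosedPoint F} (hx : x.degree = 1) :
    PowerSeries.coeff 1 (eulerFactor π n f x) = charAt π n f x := by
  have hinv : (1 - PowerSeries.C (charAt π n f x : CycField F) * PowerSeries.X ^ x.degree) *
      eulerFactor π n f x = 1 :=
    PowerSeries.mul_inv_cancel _ (by simp [x.degree_pos.ne'])
  have hcoeff := congrArg (PowerSeries.coeff 1) hinv
  rw [hx, pow_one, PowerSeries.coeff_one_mul, constantCoeff_eulerFactor] at hcoeff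
  simpa [PowerSeries.coeff_one, PowerSeries.coeff_C, sub_eq_zero, add_comm,
    ← sub_eq_add_neg] using hcoeff

theorem coeff_one_lSeries_eq_sum_charAt (n : ℕ) (f : F[X]) :
    PowerSeries.coeff 1 (lSeries π n f) =
      ∑ c : F, (charAt π n f (.affine c) : CycField F) := by
  calc PowerSeries.coeff 1 (lSeries π n f)
      = ∑ x ∈ (ClosedPoint.finite_degree_le F 1).toFinset,
          PowerSeries.coeff 1 (eulerFactor π n f x) := by
        rw [lSeries, PowerSeries.coeff_mk, coeff_one_prod_of_constantCoeff_eq_one _ _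
          fun x _ => constantCoeff_eulerFactor π n f x]
    _ = ∑ x ∈ (ClosedPoint.finite_degree_le F 1).toFinset, (charAt π n f x : CycField F) := by
        refine Finset.sum_congr rfl fun x hx => coeff_one_eulerFactor π n f ?_
        exact ((Set.Finite.mem_toFinset _).1 hx).antisymm x.degree_pos
    _ = ∑ c : F, (charAt π n f (.affine c) : CycField F) := by
        simp [ClosedPoint.sum_degree_le_one, charAt]

theorem charAt_affine {n : ℕ} (hn : n ∣ Fintype.card F - 1) (f : F[X]) (c : F) :
    charAt π n f (.affine c) = (teichmuller π ^ ((Fintype.card F - 1) / n)) (f.eval c) := by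
  have hm : (Fintype.card F - 1) / n ≠ 0 := (div_pos_of_dvd_card_sub_one hn).ne'
  by_cases hc : f.eval c = 0
  · rw [ClosedPoint.affine, charAt, if_pos (dvd_iff_isRoot.2 hc), hc, MulChar.map_zero]
  · rw [ClosedPoint.affine, charAt, if_neg (mt dvd_iff_isRoot.1 hc), galoisChar,
      kummer_frobenius_X_sub_C hn hc, map_pow, MulChar.pow_apply' _ hm]

end LSeries

/-- The character sum `∑ A(c) B(c - 1) C(c - α)`, the finite field analogue of Euler's integral for
the hypergeometric function `₂F₁`. -/
def hypergeometricSum {F R : Type*} [Field F] [Fintype F] [CommSemiring R] (A B C : MulChar F R)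
    (α : F) : R :=
  ∑ c, A c * B (c - 1) * C (c - α)

theorem hypergeometricSum_eq_apply_mul {F R : Type*} [Field F] [Fintype F] [CommSemiring R]
    {A B : MulChar F R} (hAB : (A * B) ^ 2 = 1) {α : F} (hα : α ≠ 0) :
    hypergeometricSum A B B α = (A * B) α * hypergeometricSum A B B α := by
  have hinv : Function.Involutive fun c : F => α / c := fun _ => div_div_cancel₀ hα
  have hterm (c : F) : A (α / c) * B (α / c - 1) * B (α / c - α) =
      (A * B) α * (A c * B (c - 1) * B (c - α)) := by
    rcases eq_or_ne c 0 with rfl | hc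
    · simp [MulChar.map_zero]
    have hA : A c⁻¹ = A c * B (c ^ 2) := by
      have hsq : A (c ^ 2) * B (c ^ 2) = 1 := by
        rw [← MulChar.mul_apply, map_pow, ← MulChar.pow_apply' _ two_ne_zero, hAB,
          MulChar.one_apply hc.isUnit]
      calc A c⁻¹ = A c⁻¹ * (A (c ^ 2) * B (c ^ 2)) := by rw [hsq, mul_one]
        _ = A c * B (c ^ 2) := by
          rw [← mul_assoc, ← map_mul, pow_two, inv_mul_cancel_left₀ hc]
    have hB : c ^ 2 * ((α / c - 1) * (α / c - α)) = α * ((c - 1) * (c - α)) := by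
      field_simp
      ring
    calc A (α / c) * B (α / c - 1) * B (α / c - α)
        = A α * A c * B (c ^ 2 * ((α / c - 1) * (α / c - α))) := by
          rw [div_eq_mul_inv, map_mul A, hA, map_mul B, map_mul B (_ - _)]
          ring
      _ = (A * B) α * (A c * B (c - 1) * B (c - α)) := by
          rw [hB, map_mul, map_mul, MulChar.mul_apply]
          ring
  calc hypergeometricSum A B B α
      = ∑ c, A (α / c) * B (α / c - 1) * B (α / c - α) := (Equiv.sum_comp hinv.toPerm _).symm
    _ = (A * B) α * hypergeometricSum A B B α := by
      rw [hypergeometricSum, Finset.mul_sum]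
      exact Finset.sum_congr rfl fun c _ => hterm c

theorem coeff_one_lSeries_curvePoly {F : Type*} [Field F] [Fintype F] (π : 𝓞 (CycField F) →+* F)
    {n n₁ n₂ n₃ : ℕ} (hn : n ∣ Fintype.card F - 1) (hn₁ : n₁ ≠ 0) (hn₂ : n₂ ≠ 0) (hn₃ : n₃ ≠ 0)
    (α : F) :
    PowerSeries.coeff 1 (lSeries π n (curvePoly n₁ n₂ n₃ α)) =
      hypergeometricSum (teichmuller π ^ (n₁ * ((Fintype.card F - 1) / n)))
        (teichmuller π ^ (n₂ * ((Fintype.card F - 1) / n)))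
        (teichmuller π ^ (n₃ * ((Fintype.card F - 1) / n))) α := by
  rw [coeff_one_lSeries_eq_sum_charAt, hypergeometricSum]
  refine .trans (Finset.sum_congr rfl fun c _ => congrArg (algebraMap _ _) ?_)
    (map_sum (algebraMap (𝓞 (CycField F)) (CycField F)) _ _).symm
  rw [charAt_affine π hn, curvePoly]
  simp only [eval_mul, eval_pow, eval_sub, eval_X, eval_one, eval_C, map_mul, map_pow]
  simp only [mul_comm _ ((Fintype.card F - 1) / n), pow_mul (teichmuller π),
    MulChar.pow_apply' _ hn₁, MulChar.pow_apply' _ hn₂, MulChar.pow_apply' _ hn₃]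

theorem even_of_dvd_two_mul_of_not_dvd {N a : ℕ} (h : N ∣ 2 * a) (ha : ¬N ∣ a) : Even N := by
  by_contra hN
  exact ha ((Nat.coprime_two_right.2 (Nat.not_even_iff_odd.1 hN)).dvd_of_dvd_mul_left h)

theorem pow_eq_neg_one_of_dvd_two_mul {M : Type*} [Monoid M] [HasDistribNeg M] {x : M} {N a : ℕ}
    (hx : x ^ (N / 2) = -1) (h : N ∣ 2 * a) (ha : ¬N ∣ a) : x ^ a = -1 := by
  obtain ⟨m, rfl⟩ := (even_of_dvd_two_mul_of_not_dvd h ha).two_dvd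
  obtain ⟨k, rfl⟩ : m ∣ a := Nat.dvd_of_mul_dvd_mul_left two_pos h
  have hk : Odd k := by
    by_contra hk
    obtain ⟨j, rfl⟩ := (Nat.not_odd_iff_even.1 hk).two_dvd
    exact ha ⟨j, by ring⟩
  rw [Nat.mul_div_cancel_left m two_pos] at hx
  rw [pow_mul, hx, hk.neg_one_pow]

theorem mulChar_pow_eq_one_of_card_sub_one_dvd {F R : Type*} [Field F] [Fintype F]
    [CommMonoidWithZero R] (χ : MulChar F R) {k : ℕ} (hk : Fintype.card F - 1 ∣ k) : χ ^ k = 1 := by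
  classical
  obtain ⟨m, rfl⟩ := hk
  rw [pow_mul, ← Fintype.card_units, MulChar.pow_card_eq_one, one_pow]

theorem teichmuller_neg_one {F : Type*} [Field F] [Fintype F] (π : 𝓞 (CycField F) →+* F)
    (hF : Even (Fintype.card F - 1)) : teichmuller π (-1) = -1 := by
  have hodd : Fintype.card F % 2 = 1 :=
    Nat.odd_iff.1 ((Nat.even_sub' Fintype.card_pos).1 hF |>.2 odd_one)
  have hneg : (-1 : F) ≠ 1 :=
    Ring.neg_one_ne_one_of_char_ne_two fun h => by
      simp [FiniteField.even_card_of_char_two h] at hodd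
  have hsq : teichmuller π (-1) ^ 2 = 1 := by rw [← map_pow, neg_one_sq, map_one]
  refine (sq_eq_one_iff.1 hsq).resolve_left fun h => hneg ?_
  rw [← teichmuller_spec π (-1), h, map_one]

theorem teichmuller_pow_apply_eq_neg_one {F : Type*} [Field F] [Fintype F]
    (π : 𝓞 (CycField F) →+* F) {α : F} {a : ℕ} (hα : α ^ ((Fintype.card F - 1) / 2) = -1)
    (h : Fintype.card F - 1 ∣ 2 * a) (ha : ¬Fintype.card F - 1 ∣ a) :
    (teichmuller π ^ a) α = -1 := by
  have ha0 : a ≠ 0 := fun h0 => ha (h0 ▸ dvd_zero _)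
  rw [MulChar.pow_apply' _ ha0, ← map_pow, pow_eq_neg_one_of_dvd_two_mul hα h ha,
    teichmuller_neg_one π (even_of_dvd_two_mul_of_not_dvd h ha)]

end JacobiLSeries

theorem lemma5p2 {F : Type*} [Field F] [Fintype F]
    (π : 𝓞 (CycField F) →+* F)
    (n n₁ n₂ n₃ : ℕ) (hn : n ∣ Fintype.card F - 1)
    (hn₁ : 0 < n₁ ∧ n₁ < n) (hn₂ : 0 < n₂ ∧ n₂ < n) (hn₃ : 0 < n₃ ∧ n₃ < n)
    (a₁ a₂ a₃ : ℕ) (ha₁ : a₁ = n₁ * ((Fintype.card F - 1) / n))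
    (ha₂ : a₂ = n₂ * ((Fintype.card F - 1) / n)) (ha₃ : a₃ = n₃ * ((Fintype.card F - 1) / n))
    (h32 : a₃ = a₂) (h2 : Fintype.card F - 1 ∣ 2 * (a₁ + a₂))
    (hne : a₁ + a₂ ≠ Fintype.card F - 1)
    (α : F) (hα : α ^ ((Fintype.card F - 1) / 2) = -1) :
    PowerSeries.coeff 1 (lSeries π n (curvePoly n₁ n₂ n₃ α)) = 0 := by
  have hm := div_pos_of_dvd_card_sub_one hn
  have hlt₁ : a₁ < Fintype.card F - 1 := ha₁ ▸ mul_div_lt_card_sub_one hn hn₁.2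
  have hlt₂ : a₂ < Fintype.card F - 1 := ha₂ ▸ mul_div_lt_card_sub_one hn hn₂.2
  have hpos : a₁ + a₂ ≠ 0 := (Nat.add_pos_left (ha₁ ▸ Nat.mul_pos hn₁.1 hm) a₂).ne'
  have hndvd : ¬Fintype.card F - 1 ∣ a₁ + a₂ := fun h =>
    hne (Nat.eq_of_dvd_of_lt_two_mul hpos h (by omega))
  have hχα : (teichmuller π ^ a₁ * teichmuller π ^ a₂) α = -1 := by
    rw [← pow_add]
    exact teichmuller_pow_apply_eq_neg_one π hα h2 hndvd
  have hquad : (teichmuller π ^ a₁ * teichmuller π ^ a₂) ^ 2 = 1 := by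
    rw [← pow_add, ← pow_mul, mul_comm]
    exact mulChar_pow_eq_one_of_card_sub_one_dvd _ h2
  have hα0 : α ≠ 0 := by
    rintro rfl
    simp [MulChar.map_zero] at hχα
  have hsum := hypergeometricSum_eq_apply_mul hquad hα0
  rw [hχα, neg_one_mul, CharZero.eq_neg_self_iff] at hsum
  rw [coeff_one_lSeries_curvePoly π hn hn₁.1.ne' hn₂.1.ne' hn₃.1.ne', ← ha₁, ← ha₂, ← ha₃, h32,
    hsum]
  exact map_zero (algebraMap _ _)
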